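/- Let $q$ be a prime power. Let $V$ be a vector space of dimension $n+1$ over $\mathbb F_q$ and let $\mathrm{PG}(n,q)$ be the projective space whose $m$-spaces are the $(m+1)$-dimensional linear subspaces of $V$. Fix a hyperplane $\pi_\infty$ of $\mathrm{PG}(n,q)$; the $m$-spaces not contained in $\pi_\infty$ are the $m$-spaces of $\mathrm{AG}(n,q)$, and points are $0$-spaces. Let $A$ be the real $0/1$ incidence matrix of $\mathrm{AG}(n,q)$ with rows indexed by the points and columns by the $k$-spaces. A set $\mathcal L$ of $k$-spaces of $\mathrm{AG}(n,q)$ is a *Cameron–Liebler $k$-set* if its characteristic vector lies in $\operatorname{Im}(A^{T})$; its *parameter* is $x=|\mathcal L|/\genfrac{[}{]}{0pt}{}{n}{k}_q$, where $\genfrac{[}{]}{0pt}{}{a}{b}_q=\prod_{j=0}^{b-1}\frac{q^{a-j}-1}{q^{j+1}-1}$. A Cameron–Liebler line class is a Cameron–Liebler $1$-set. Let $\mathcal L$ be a Cameron–Liebler $k$-set of $\mathrm{AG}(n,q)$ with parameter $x$. (1) Let $0\le i\le k-2$ and $n\ge 2k-i$, let $I$ be an $i$-space contained in $\pi_\infty$,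 and let $\pi$ be an $(n-i-1)$-space of $\mathrm{PG}(n,q)$ skew to $I$. Then $\pi\cap\pi_\infty$ is a hyperplane of $\pi$, so that $\pi_A=\pi\setminus\pi_\infty$ is an $\mathrm{AG}(n-i-1,q)$, and the set $$\mathcal J=\{K\cap\pi \mid K\in\mathcal L,\ I\subseteq K\}$$ is a Cameron–Liebler $(k-i-1)$-set of $\pi_A$ with the same parameter $x$. (2) Let $k\ge 1$ and $n\ge k+2$. Then $x$ satisfies every condition that holds for the parameters of Cameron–Liebler line classes in $\mathrm{AG}(n-k+1,q)$; that is, for every property $P$ of rational numbers, if $P(y)$ holds for the parameter $y$ of each Cameron–Liebler line class of $\mathrm{AG}(n-k+1,q)$, then $P(x)$ holds. -/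

import Mathlib

/-- The Gaussian binomial coefficient `[a choose b]_q`. It vanishes for `b > a` (the factor with
`j = a` is zero) and there is no truncated subtraction that matters for `b ≤ a`. -/
def gaussBinom (q a b : ℕ) : ℚ :=
  ∏ j ∈ Finset.range b, ((q : ℚ) ^ (a - j) - 1) / ((q : ℚ) ^ (j + 1) - 1)

/-- `H` is a hyperplane of the projective space of dimension `n` whose subspaces are the linear
subspaces of `V` (an `m`-space being a linear subspace of rank `m + 1`). Removing `H`, the
hyperplane at infinity, leaves the affine space `AG(n, q)`. -/
structure IsAG {F V : Type*} [Field F] [AddCommGroup V] [Module F V]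
    (H : Submodule F V) (n : ℕ) : Prop where
  finrank_total : Module.finrank F V = n + 1
  finrank_infinity : Module.finrank F H = n

/-- `K` is a `k`-space of the affine space with hyperplane at infinity `H`: a projective `k`-space
not contained in `H`. The affine points are the case `k = 0`. -/
def IsAffineSpace {F V : Type*} [Field F] [AddCommGroup V] [Module F V]
    (H : Submodule F V) (k : ℕ) (K : Submodule F V) : Prop :=
  Module.finrank F K = k + 1 ∧ ¬ K ≤ H

/-- The type of all `k`-spaces of the affine space with hyperplane at infinity `H`. -/
abbrev AffineSpaces {F V : Type*} [Field F] [AddCommGroup V] [Module F V]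
    (H : Submodule F V) (k : ℕ) : Type _ :=
  {K : Submodule F V // IsAffineSpace H k K}

noncomputable instance affineSpacesFintype {F V : Type*} [Field F] [Finite F] [AddCommGroup V]
    [Module F V] [FiniteDimensional F V] (H : Submodule F V) (k : ℕ) :
    Fintype (AffineSpaces H k) :=
  haveI : Finite V := Module.finite_of_finite F
  haveI : Finite (Submodule F V) := Finite.of_injective _ SetLike.coe_injective
  Fintype.ofFinite _

open Classical in
/-- The point-(`k`-space) incidence matrix of the affine space. -/
noncomputable def incidenceMatrix {F V : Type*} [Field F] [AddCommGroup V] [Module F V]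
    (H : Submodule F V) (k : ℕ) : Matrix (AffineSpaces H 0) (AffineSpaces H k) ℝ :=
  Matrix.of fun p K => if p.1 ≤ K.1 then 1 else 0

open Classical in
/-- The characteristic vector of a set of affine `k`-spaces. -/
noncomputable def charVector {F V : Type*} [Field F] [AddCommGroup V] [Module F V]
    (H : Submodule F V) (k : ℕ) (L : Set (Submodule F V)) : AffineSpaces H k → ℝ :=
  fun K => if K.1 ∈ L then 1 else 0

/-- `L` is a Cameron-Liebler `k`-set of the affine space with hyperplane at infinity `H`: a set of
affine `k`-spaces whose characteristic vector lies in the image of the transpose of the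
point-(`k`-space) incidence matrix. -/
structure IsCameronLiebler {F V : Type*} [Field F] [Finite F] [AddCommGroup V] [Module F V]
    [FiniteDimensional F V] (H : Submodule F V) (k : ℕ) (L : Set (Submodule F V)) : Prop where
  isAffineSpace : ∀ K ∈ L, IsAffineSpace H k K
  charVector_mem : charVector H k L ∈ LinearMap.range (incidenceMatrix H k).transpose.mulVecLin

/-- The parameter `|L| / [n choose k]_q` of a Cameron-Liebler `k`-set `L` of `AG(n, q)`, where `q`
is the order of `F`. -/
noncomputable def clParameter {F V : Type*} [Field F] [AddCommGroup V] [Module F V]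
    (n k : ℕ) (L : Set (Submodule F V)) : ℚ :=
  (L.ncard : ℚ) / gaussBinom (Nat.card F) n k

/-- The subspaces `K ∩ π` of `π`, where `K` ranges over the elements of `L` through `I`. For `π`
complementary to `I` this is the projection from `I` onto `π` of the elements of `L` through `I`.
The subspace `K ∩ π` is viewed as a subspace of the projective space `π`. -/
def projectedSet {F V : Type*} [Field F] [AddCommGroup V] [Module F V]
    (L : Set (Submodule F V)) (I π : Submodule F V) : Set (Submodule F π) :=
  {N | ∃ K ∈ L, I ≤ K ∧ N = K.comap π.subtype}

/-- The hyperplane `x₀ = 0` of `F ^ (m + 1)`, the hyperplane at infinity of the standard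
`AG(m, q)`. -/
def stdInfinity (F : Type*) [Field F] (m : ℕ) : Submodule F (Fin (m + 1) → F) :=
  LinearMap.ker (LinearMap.proj (0 : Fin (m + 1)) : (Fin (m + 1) → F) →ₗ[F] F)

/-! Let `ρ : V → W` be a linear surjection with `ρ⁻¹ H' = H`, so that its kernel lies at infinity.
Affine points then map to affine points, and `p ≤ ρ⁻¹ N` iff `ρ p ≤ N`. If `Aᵀ f` is the
characteristic vector of `L`, summing `f` over the fibres of `ρ` therefore gives a weight
representing `{N | ρ⁻¹ N ∈ L}`. The total weight does not change, and it equals the parameter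
because every affine point lies on `[n choose k]_q` of the `k`-spaces (`sum_eq_clParameter`). This
is `IsCameronLiebler.comap_mem`. Claim (1) takes for `ρ` the projection onto `π` along `I`; claim
(2) takes a coordinate projection with kernel of rank `k - 1`. -/

open Finset in
-- The truncated `a - 1` does no harm: for `a = 0` both sides vanish.
theorem gaussBinom_succ_succ {q : ℕ} (hq : 1 < q) (a b : ℕ) :
    gaussBinom q a (b + 1) * ((q : ℚ) ^ (b + 1) - 1) =
      ((q : ℚ) ^ a - 1) * gaussBinom q (a - 1) b := by
  have hne : ∀ j : ℕ, (q : ℚ) ^ (j + 1) - 1 ≠ 0 := fun j =>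
    (sub_pos.2 (one_lt_pow₀ (by exact_mod_cast hq) (Nat.succ_ne_zero j))).ne'
  have hprod : ∏ j ∈ range b, ((q : ℚ) ^ (j + 1) - 1) ≠ 0 := prod_ne_zero_iff.2 fun j _ => hne j
  have hsub : ∏ j ∈ range b, ((q : ℚ) ^ (a - (j + 1)) - 1) =
      ∏ j ∈ range b, ((q : ℚ) ^ (a - 1 - j) - 1) :=
    prod_congr rfl fun j _ => by rw [Nat.sub_sub, add_comm]
  unfold gaussBinom
  rw [prod_div_distrib, prod_div_distrib, prod_range_succ', prod_range_succ]
  rw [hsub, Nat.sub_zero]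
  have := hne b
  field_simp

theorem gaussBinom_pos {q : ℕ} (hq : 1 < q) {a b : ℕ} (h : b ≤ a) : 0 < gaussBinom q a b := by
  have hq' : (1 : ℚ) < q := by exact_mod_cast hq
  refine Finset.prod_pos fun j hj => div_pos ?_ ?_
  · have := Finset.mem_range.1 hj
    exact sub_pos.2 (one_lt_pow₀ hq' (by omega))
  · exact sub_pos.2 (one_lt_pow₀ hq' (by omega))

/-! ### Counting subspaces, and coordinates adapted to a hyperplane -/

section LinearAlgebra

open Module

variable {F V W : Type*} [Field F] [AddCommGroup V] [Module F V] [AddCommGroup W] [Module F W]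

theorem finrank_comap_add_finrank_ker_of_surjective [FiniteDimensional F V] {ρ : V →ₗ[F] W}
    (hρ : Function.Surjective ρ) (N : Submodule F W) :
    finrank F (N.comap ρ) = finrank F N + finrank F (LinearMap.ker ρ) := by
  have h := (ρ.domRestrict (N.comap ρ)).finrank_range_add_finrank_ker
  have hr : LinearMap.range (ρ.domRestrict (N.comap ρ)) = N := by
    rw [LinearMap.range_domRestrict, Submodule.map_comap_eq_of_surjective hρ]
  have hk : LinearMap.ker (ρ.domRestrict (N.comap ρ)) =
      (LinearMap.ker ρ).comap (N.comap ρ).subtype := by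
    ext x; simp
  have hle : LinearMap.ker ρ ≤ N.comap ρ := fun x hx => by
    rw [Submodule.mem_comap, LinearMap.mem_ker.1 hx]; exact N.zero_mem
  rw [hr, hk, (Submodule.comapSubtypeEquivOfLe hle).finrank_eq] at h
  exact h.symm

theorem finite_submodule [Finite F] [FiniteDimensional F V] : Finite (Submodule F V) :=
  haveI : Finite V := Module.finite_of_finite F
  Finite.of_injective _ SetLike.coe_injective

/-- The subspaces of rank `b + rank U` through `U` correspond to the subspaces of rank `b` of the
quotient by `U`. -/
theorem card_submodule_through [FiniteDimensional F V] (U : Submodule F V) (b d : ℕ)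
    (hU : finrank F U = d) :
    Nat.card {K : Submodule F V // finrank F K = b + d ∧ U ≤ K} =
      Nat.card {N : Submodule F (V ⧸ U) // finrank F N = b} := by
  have hfr (N : Submodule F (V ⧸ U)) : finrank F (N.comap U.mkQ) = finrank F N + d := by
    rw [finrank_comap_add_finrank_ker_of_surjective U.mkQ_surjective, Submodule.ker_mkQ, hU]
  have hle (N : Submodule F (V ⧸ U)) : U ≤ N.comap U.mkQ := Submodule.le_comap_mkQ U N
  refine (Nat.card_congr (Equiv.ofBijective
    (fun N => ⟨N.1.comap U.mkQ, by rw [hfr, N.2], hle N.1⟩) ⟨?_, ?_⟩)).symm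
  · intro N N' h
    exact Subtype.ext (Submodule.comap_injective_of_surjective U.mkQ_surjective
      (congrArg Subtype.val h))
  · rintro ⟨K, hK, hUK⟩
    have hc : (K.map U.mkQ).comap U.mkQ = K := by
      rw [Submodule.comap_map_mkQ, sup_eq_right.2 hUK]
    refine ⟨⟨K.map U.mkQ, ?_⟩, Subtype.ext hc⟩
    have := hfr (K.map U.mkQ)
    rw [hc, hK] at this
    omega

/-- Double count of the pairs `(v, K)` with `v` a nonzero vector of `K`. -/
theorem card_submodule_mul [Finite F] [FiniteDimensional F V] (b : ℕ) (N : ℚ)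
    (hN : ∀ v : V, v ≠ 0 →
      (Nat.card {K : Submodule F V // finrank F K = b + 1 ∧ F ∙ v ≤ K} : ℚ) = N) :
    (Nat.card {K : Submodule F V // finrank F K = b + 1} : ℚ) * ((Nat.card F : ℚ) ^ (b + 1) - 1) =
      ((Nat.card F : ℚ) ^ finrank F V - 1) * N := by
  classical
  have : Finite V := Module.finite_of_finite F
  have : Finite (Submodule F V) := finite_submodule
  have := Fintype.ofFinite F
  have := Fintype.ofFinite V
  have := Fintype.ofFinite {K : Submodule F V // finrank F K = b + 1}
  have hcard (U : Submodule F V) :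
      ∑ v : V, (if v ≠ 0 ∧ v ∈ U then 1 else 0 : ℚ) = (Nat.card F : ℚ) ^ finrank F U - 1 := by
    have h1 : ((Finset.univ.filter fun v : V => v ∈ U).card : ℚ) =
        (Nat.card F : ℚ) ^ finrank F U := by
      have h := Module.natCard_eq_pow_finrank (K := F) (V := U)
      rw [← Fintype.card_subtype, ← Nat.card_eq_fintype_card]
      exact_mod_cast h
    have h2 : (Finset.univ.filter fun v : V => v ≠ 0 ∧ v ∈ U) =
        (Finset.univ.filter fun v : V => v ∈ U).erase 0 := by
      ext v; simp
    rw [Finset.sum_boole, h2, Finset.card_erase_of_mem (by simp), Nat.cast_sub, h1]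
    · simp
    · exact Finset.card_pos.2 ⟨0, by simp⟩
  calc
    _ = ∑ K : {K : Submodule F V // finrank F K = b + 1},
          ∑ v : V, (if v ≠ 0 ∧ v ∈ K.1 then 1 else 0 : ℚ) := by
      rw [Finset.sum_congr rfl fun K _ => (hcard K.1).trans (by rw [K.2]), Finset.sum_const,
        nsmul_eq_mul, Finset.card_univ, Nat.card_eq_fintype_card]
    _ = ∑ v : V, (if v ≠ 0 ∧ v ∈ (⊤ : Submodule F V) then 1 else 0) * N := by
      rw [Finset.sum_comm]
      refine Finset.sum_congr rfl fun v _ => ?_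
      by_cases hv : v = 0
      · simp [hv]
      · rw [← hN v hv]
        simp only [ne_eq, hv, not_false_eq_true, true_and, Submodule.mem_top, if_true, one_mul,
          Finset.sum_boole, Submodule.span_singleton_le_iff_mem]
        rw [← Fintype.card_subtype, ← Nat.card_eq_fintype_card]
        exact congrArg _ (Nat.card_congr (Equiv.subtypeSubtypeEquivSubtypeInter
          (fun K : Submodule F V => finrank F K = b + 1) (fun K => v ∈ K)))
    _ = _ := by
      rw [← Finset.sum_mul, hcard, finrank_top]

/-- The induction on `b` must keep `V` general, since its step passes to the quotient of `V` by a
line. -/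
theorem natCard_submodule_finrank_eq {F : Type*} [Field F] [Finite F] (b : ℕ) :
    ∀ {V : Type*} [AddCommGroup V] [Module F V] [FiniteDimensional F V],
      (Nat.card {K : Submodule F V // finrank F K = b} : ℚ) =
        gaussBinom (Nat.card F) (finrank F V) b := by
  induction b with
  | zero =>
    intro V _ _ _
    have : Unique {K : Submodule F V // finrank F K = 0} :=
      { default := ⟨⊥, finrank_bot F V⟩
        uniq := fun K => Subtype.ext (Submodule.finrank_eq_zero.1 K.2) }
    simp [gaussBinom]
  | succ b ih =>
    intro V _ _ _
    have hq : 1 < Nat.card F := Finite.one_lt_card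
    have hne : ((Nat.card F : ℚ) ^ (b + 1) - 1) ≠ 0 :=
      (sub_pos.2 (one_lt_pow₀ (by exact_mod_cast hq) (Nat.succ_ne_zero b))).ne'
    refine mul_right_cancel₀ hne ?_
    rw [gaussBinom_succ_succ hq]
    refine card_submodule_mul b _ fun v hv => ?_
    have h1 : finrank F (F ∙ v) = 1 := finrank_span_singleton hv
    rw [card_submodule_through (F ∙ v) b 1 h1, ih, Submodule.finrank_quotient, h1]

/-- Some linear isomorphism onto `F ^ (n + 1)` sends a given hyperplane to `x₀ = 0`. -/
theorem IsAG.exists_equiv [FiniteDimensional F V] {H : Submodule F V} {n : ℕ} (hAG : IsAG H n) :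
    ∃ e : V ≃ₗ[F] (Fin (n + 1) → F), (stdInfinity F n).comap e.toLinearMap = H := by
  obtain ⟨hV, hH⟩ := hAG
  obtain ⟨v, hv⟩ : ∃ v, v ∉ H := by
    by_contra! h
    rw [(eq_top_iff.2 fun v _ => h v : H = ⊤), finrank_top] at hH
    omega
  have hsup : H ⊔ F ∙ v = ⊤ := by
    refine Submodule.eq_top_of_finrank_eq ?_
    rw [Submodule.finrank_sup_span_singleton hv, hH, hV]
  have hli : ∀ (c : F), ∀ x ∈ H, c • v + x = 0 → c = 0 := by
    intro c x hx h
    by_contra hc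
    refine hv ((H.smul_mem_iff hc).1 ?_)
    rw [eq_neg_of_add_eq_zero_left h]
    exact H.neg_mem hx
  have hsp : ∀ z : V, ∃ c : F, z + c • v ∈ H := by
    intro z
    obtain ⟨y, hy, w, hw, rfl⟩ := Submodule.mem_sup.1 (hsup ▸ Submodule.mem_top : z ∈ H ⊔ F ∙ v)
    obtain ⟨c, rfl⟩ := Submodule.mem_span_singleton.1 hw
    exact ⟨-c, by simpa using hy⟩
  -- A basis of `H` preceded by `v ∉ H`: coordinate `0` then vanishes exactly on `H`.
  let b' : Basis (Fin n) F H := finBasisOfFinrankEq F H hH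
  let b := Basis.mkFinCons v b' hli hsp
  refine ⟨b.equivFun, ?_⟩
  have hmem (x : V) : x ∈ (stdInfinity F n).comap b.equivFun.toLinearMap ↔ b.repr x 0 = 0 :=
    Iff.rfl
  have hle : H ≤ (stdInfinity F n).comap b.equivFun.toLinearMap := by
    rw [← H.map_subtype_top, ← b'.span_eq, Submodule.map_span, Submodule.span_le]
    rintro _ ⟨_, ⟨i, rfl⟩, rfl⟩
    rw [SetLike.mem_coe, hmem]
    have : b i.succ = (b' i : V) := by simp [b]
    rw [Submodule.subtype_apply, ← this, b.repr_self]
    simp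
  refine (Submodule.eq_of_le_of_finrank_eq hle ?_).symm
  refine le_antisymm (Submodule.finrank_mono hle) ?_
  have hlt : (stdInfinity F n).comap b.equivFun.toLinearMap ≠ ⊤ := by
    intro h
    have : b 0 ∈ (stdInfinity F n).comap b.equivFun.toLinearMap := h ▸ Submodule.mem_top
    simp [hmem] at this
  have := Submodule.finrank_lt hlt
  omega

theorem isAG_stdInfinity (F : Type*) [Field F] (m : ℕ) : IsAG (stdInfinity F m) m := by
  have h : finrank F (Fin (m + 1) → F) = m + 1 := by simp
  refine ⟨h, ?_⟩
  let φ : (Fin (m + 1) → F) →ₗ[F] F := LinearMap.proj 0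
  have hr : finrank F (LinearMap.range φ) + finrank F (stdInfinity F m) = _ :=
    φ.finrank_range_add_finrank_ker
  rw [LinearMap.range_eq_top.2 (LinearMap.proj_surjective 0), finrank_top, finrank_self, h] at hr
  omega

/-- The image has rank at most `1`, and it is nonzero because it is not inside `H'`. -/
theorem IsAffineSpace.map_point [FiniteDimensional F V] {H : Submodule F V} {ρ : V →ₗ[F] W} {H' : Submodule F W}
    (hH : H'.comap ρ = H) {p : Submodule F V} (hp : IsAffineSpace H 0 p) :
    IsAffineSpace H' 0 (p.map ρ) := by
  have hle : ¬ p.map ρ ≤ H' := by rw [Submodule.map_le_iff_le_comap, hH]; exact hp.2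
  refine ⟨le_antisymm ((Submodule.finrank_map_le ρ p).trans hp.1.le) ?_, hle⟩
  refine Nat.one_le_iff_ne_zero.2 fun h => hle ?_
  rw [Submodule.finrank_eq_zero.1 h]
  exact bot_le

theorem isAffineSpace_comap_iff [FiniteDimensional F V] {H : Submodule F V} {ρ : V →ₗ[F] W} {H' : Submodule F W}
    (hρ : Function.Surjective ρ) (hH : H'.comap ρ = H) {k : ℕ} {N : Submodule F W} :
    IsAffineSpace H (k + finrank F (LinearMap.ker ρ)) (N.comap ρ) ↔ IsAffineSpace H' k N := by
  rw [IsAffineSpace, IsAffineSpace, ← hH, Submodule.comap_le_comap_iff_of_surjective hρ,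
    finrank_comap_add_finrank_ker_of_surjective hρ]
  constructor <;> rintro ⟨h1, h2⟩ <;> exact ⟨by omega, h2⟩

end LinearAlgebra

/-! ### Weights on points, the parameter, and passage to quotients -/

section CameronLiebler

open Module

variable {F V W : Type*} [Field F] [Finite F] [AddCommGroup V] [Module F V]
  [FiniteDimensional F V] [AddCommGroup W] [Module F W] [FiniteDimensional F W]

/-- A subspace through an affine point is never inside `H`, so the count is that of all subspaces of
rank `k` in the quotient by that point. -/
theorem natCard_affineSpaces_through {H : Submodule F V} {n : ℕ} (hAG : IsAG H n) (k : ℕ)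
    (p : AffineSpaces H 0) :
    (Nat.card {K : AffineSpaces H k // p.1 ≤ K.1} : ℚ) = gaussBinom (Nat.card F) n k := by
  have hp : finrank F p.1 = 1 := p.2.1
  have e : {K : AffineSpaces H k // p.1 ≤ K.1} ≃
      {K : Submodule F V // finrank F K = k + 1 ∧ p.1 ≤ K} :=
    { toFun := fun K => ⟨K.1.1, K.1.2.1, K.2⟩
      invFun := fun K => ⟨⟨K.1, K.2.1, fun h => p.2.2 (K.2.2.trans h)⟩, K.2.2⟩
      left_inv := fun _ => rfl
      right_inv := fun _ => rfl }
  rw [Nat.card_congr e, card_submodule_through p.1 k 1 hp, natCard_submodule_finrank_eq,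
    Submodule.finrank_quotient, hp, hAG.finrank_total, Nat.add_sub_cancel]

open Classical in
theorem incidenceMatrix_transpose_mulVec (H : Submodule F V) (k : ℕ) (f : AffineSpaces H 0 → ℝ)
    (K : AffineSpaces H k) :
    (incidenceMatrix H k).transpose.mulVecLin f K = ∑ p, if p.1 ≤ K.1 then f p else 0 := by
  simp [Matrix.vecMul, dotProduct, incidenceMatrix]

/-- The parameter is the total weight of any function on the points that represents the
characteristic vector. -/
theorem sum_eq_clParameter {H : Submodule F V} {n k : ℕ} (hAG : IsAG H n) (hk : k ≤ n)
    {L : Set (Submodule F V)} (hL : ∀ K ∈ L, IsAffineSpace H k K) {f : AffineSpaces H 0 → ℝ}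
    (hf : (incidenceMatrix H k).transpose.mulVecLin f = charVector H k L) :
    ∑ p, f p = (clParameter n k L : ℝ) := by
  classical
  have hg : (gaussBinom (Nat.card F) n k : ℝ) ≠ 0 := by
    exact_mod_cast (gaussBinom_pos Finite.one_lt_card hk).ne'
  have hcount (p : AffineSpaces H 0) : ∑ K : AffineSpaces H k, (if p.1 ≤ K.1 then f p else 0) =
      f p * gaussBinom (Nat.card F) n k := by
    rw [← natCard_affineSpaces_through hAG k p, Nat.card_eq_fintype_card, Fintype.card_subtype,
      ← Finset.sum_filter, Finset.sum_const, nsmul_eq_mul, mul_comm]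
    push_cast
    rfl
  have hcard : ∑ K, charVector H k L K = (L.ncard : ℝ) := by
    have e : {K : AffineSpaces H k // K.1 ∈ L} ≃ L :=
      { toFun := fun K => ⟨K.1.1, K.2⟩
        invFun := fun K => ⟨⟨K.1, hL K.1 K.2⟩, K.2⟩
        left_inv := fun _ => rfl
        right_inv := fun _ => rfl }
    rw [← Nat.card_coe_set_eq, ← Nat.card_congr e, Nat.card_eq_fintype_card, Fintype.card_subtype]
    simp [charVector]
  rw [clParameter, Rat.cast_div, Rat.cast_natCast, eq_div_iff hg, ← hcard, ← hf, Finset.sum_mul]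
  simp only [incidenceMatrix_transpose_mulVec, ← hcount]
  exact Finset.sum_comm

/-- A Cameron-Liebler set induces one with the same parameter on the quotient by a subspace
contained in the hyperplane at infinity. -/
theorem IsCameronLiebler.comap_mem {H : Submodule F V} {ρ : V →ₗ[F] W} {H' : Submodule F W}
    (hρ : Function.Surjective ρ) (hH : H'.comap ρ = H) {n n' k k' : ℕ} (hAG : IsAG H n)
    (hAG' : IsAG H' n') (hk : k = k' + finrank F (LinearMap.ker ρ)) (hkn : k ≤ n)
    {L : Set (Submodule F V)} (hL : IsCameronLiebler H k L) :
    IsCameronLiebler H' k' {N | N.comap ρ ∈ L} ∧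
      clParameter n' k' {N | N.comap ρ ∈ L} = clParameter n k L := by
  classical
  subst hk
  have haff : ∀ N ∈ {N : Submodule F W | N.comap ρ ∈ L}, IsAffineSpace H' k' N := fun N hN =>
    (isAffineSpace_comap_iff hρ hH).1 (hL.isAffineSpace _ hN)
  obtain ⟨f, hf⟩ := hL.charVector_mem
  let m : AffineSpaces H 0 → AffineSpaces H' 0 := fun p => ⟨p.1.map ρ, p.2.map_point hH⟩
  -- Pushforward of the weight `f` along `m`, by summation over fibres.
  let g : AffineSpaces H' 0 → ℝ := fun p' => ∑ p, if m p = p' then f p else 0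
  have hg : (incidenceMatrix H' k').transpose.mulVecLin g =
      charVector H' k' {N | N.comap ρ ∈ L} := by
    funext N
    let K : AffineSpaces H (k' + finrank F (LinearMap.ker ρ)) :=
      ⟨N.1.comap ρ, (isAffineSpace_comap_iff hρ hH).2 N.2⟩
    have hK : charVector H' k' {N | N.comap ρ ∈ L} N = charVector H _ L K := rfl
    rw [hK, ← hf, incidenceMatrix_transpose_mulVec, incidenceMatrix_transpose_mulVec]
    simp only [g, ← Finset.sum_filter (fun p' : AffineSpaces H' 0 => p'.1 ≤ N.1)]
    rw [Finset.sum_comm]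
    refine Finset.sum_congr rfl fun p _ => ?_
    rw [Finset.sum_ite_eq]
    simp [m, K, Submodule.map_le_iff_le_comap]
  have hsum : ∑ p', g p' = ∑ p, f p := by
    simp only [g]
    rw [Finset.sum_comm]
    simp
  refine ⟨⟨haff, g, hg⟩, ?_⟩
  have hkn' : k' ≤ n' := by
    have h := finrank_comap_add_finrank_ker_of_surjective hρ H'
    rw [hH, hAG.finrank_infinity, hAG'.finrank_infinity] at h
    omega
  have h1 := sum_eq_clParameter hAG hkn hL.isAffineSpace hf
  have h2 := sum_eq_clParameter hAG' hkn' haff hg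
  exact_mod_cast h2.symm.trans (hsum.trans h1)

end CameronLiebler

/-! ### Projection from a subspace at infinity -/

section Projection

open Module

variable {F V : Type*} [Field F] [AddCommGroup V] [Module F V]

/-- A vector and its projection differ by an element of `I`, hence of `K`. -/
theorem comap_projectionOnto_comap_subtype {I π K : Submodule F V} (h : IsCompl π I) (hK : I ≤ K) :
    (K.comap π.subtype).comap (π.projectionOnto I h) = K := by
  ext x
  have hx : x - (π.projectionOnto I h x : V) ∈ I := by
    rw [← Submodule.projectionOnto_apply_eq_zero_iff h, map_sub,
      Submodule.projectionOnto_apply_left, sub_self]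
  have := K.add_mem_iff_right (y := (π.projectionOnto I h x : V)) (hK hx)
  rw [sub_add_cancel] at this
  exact this.symm

theorem projectedSet_eq {I π : Submodule F V} (h : IsCompl π I) (L : Set (Submodule F V)) :
    projectedSet L I π = {N | N.comap (π.projectionOnto I h) ∈ L} := by
  ext N
  constructor
  · rintro ⟨K, hKL, hIK, rfl⟩
    rw [Set.mem_ofPred_eq, comap_projectionOnto_comap_subtype h hIK]
    exact hKL
  · intro hN
    refine ⟨_, hN, fun x hx => ?_, ?_⟩
    · rw [Submodule.mem_comap, (Submodule.projectionOnto_apply_eq_zero_iff h).2 hx]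
      exact N.zero_mem
    · ext x
      simp [Submodule.projectionOnto_apply_left h x]

theorem IsAG.comap_subtype [FiniteDimensional F V] {H I π : Submodule F V} {n m : ℕ}
    (hAG : IsAG H n) (h : IsCompl π I) (hI : I ≤ H) (hm : n = m + finrank F I) :
    IsAG (H.comap π.subtype) m := by
  have h1 := Submodule.finrank_add_eq_of_isCompl h
  have h2 := finrank_comap_add_finrank_ker_of_surjective
    (Submodule.projectionOnto_surjective h) (H.comap π.subtype)
  rw [comap_projectionOnto_comap_subtype h hI, Submodule.ker_projectionOnto,
    hAG.finrank_infinity] at h2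
  rw [hAG.finrank_total] at h1
  exact ⟨by omega, by omega⟩

end Projection

/-! ### The two claims -/

theorem theorem6p13 {F V : Type*} [Field F] [Finite F] [AddCommGroup V] [Module F V]
    [FiniteDimensional F V] (n k : ℕ) (H : Submodule F V) (hAG : IsAG H n)
    (L : Set (Submodule F V)) (hL : IsCameronLiebler H k L) :
    -- reduction through an `i`-space `I` at infinity, for `0 ≤ i ≤ k - 2` and `n ≥ 2k - i`
    (∀ (i : ℕ) (I π : Submodule F V), i + 2 ≤ k → 2 * k ≤ n + i →
      I ≤ H → Module.finrank F I = i + 1 →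
      Module.finrank F π = (n - i - 1) + 1 → Disjoint I π →
        IsAG (H.comap π.subtype) (n - i - 1) ∧
        IsCameronLiebler (H.comap π.subtype) (k - i - 1) (projectedSet L I π) ∧
        clParameter (n - i - 1) (k - i - 1) (projectedSet L I π) = clParameter n k L) ∧
    -- transfer of every condition on parameters of line classes of `AG(n - k + 1, q)`
    (1 ≤ k → k + 2 ≤ n → ∀ P : ℚ → Prop,
      (∀ M : Set (Submodule F (Fin ((n - k + 1) + 1) → F)),
        IsCameronLiebler (stdInfinity F (n - k + 1)) 1 M → P (clParameter (n - k + 1) 1 M)) →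
      P (clParameter n k L)) := by
  constructor
  · intro i I π hik hn hIH hI hπ hdis
    have hc : IsCompl π I := by
      rw [Submodule.isCompl_iff_disjoint π I (by rw [hπ, hI, hAG.finrank_total]; omega)]
      exact hdis.symm
    have hAG' : IsAG (H.comap π.subtype) (n - i - 1) :=
      hAG.comap_subtype hc hIH (by rw [hI]; omega)
    refine ⟨hAG', ?_⟩
    rw [projectedSet_eq hc]
    refine hL.comap_mem (Submodule.projectionOnto_surjective hc)
      (comap_projectionOnto_comap_subtype hc hIH) hAG hAG' ?_ (by omega)
    rw [Submodule.ker_projectionOnto, hI]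
    omega
  · intro hk hn P hP
    obtain ⟨e, he⟩ := hAG.exists_equiv
    have hle : (n - k + 1) + 1 ≤ n + 1 := by omega
    -- Keeps the first `n - k + 2` coordinates. Coordinate `0` is among them, so the standard
    -- hyperplane at infinity pulls back to `H`.
    let ρ := (LinearMap.funLeft F F (Fin.castLE hle)).comp e.toLinearMap
    have hρ : Function.Surjective ρ :=
      (LinearMap.funLeft_surjective_of_injective F F _ (Fin.castLE_injective hle)).comp
        e.surjective
    have hH : (stdInfinity F (n - k + 1)).comap ρ = H := he
    have hker : k = 1 + Module.finrank F (LinearMap.ker ρ) := by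
      have h := finrank_comap_add_finrank_ker_of_surjective hρ (stdInfinity F (n - k + 1))
      rw [hH, hAG.finrank_infinity, (isAG_stdInfinity F _).finrank_infinity] at h
      omega
    obtain ⟨h1, h2⟩ := hL.comap_mem hρ hH hAG (isAG_stdInfinity F _) hker (by omega)
    exact h2 ▸ hP _ h1
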